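/- Let $d \ge 3$ be an integer. There exists a constant $\beta_{MBM}(d) > 0$, depending only on $d$, with the following property. Let $X_1, X_2, \dots$ and $Y_1, Y_2, \dots$ be random points of $\mathbb{R}^d$, all defined on one probability space, all mutually independent and each uniformly distributed in $[0,1]^d$. For each $N$ let $$L_N = \min_{\sigma} \sum_{i=1}^{N} \lVert X_i - Y_{\sigma(i)} \rVert ,$$ where $\sigma$ ranges over the permutations of $\{1,\dots,N\}$ and $\lVert\cdot\rVert$ is the Euclidean norm; that is, $L_N$ is the minimum total Euclidean length of a bipartite (perfect) matching between $X_1,\dots,X_N$ and $Y_1,\dots,Y_N$. Then, with probability one, $$\lim_{N\to\infty} \frac{L_N}{N^{1-1/d}} = \beta_{MBM}(d).$$ -/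

import Mathlib

open MeasureTheory ProbabilityTheory Filter Topology

/-- The unit cube `[0,1]^d` in `d`-dimensional Euclidean space. -/
def unitCube (d : ℕ) : Set (EuclideanSpace ℝ (Fin d)) :=
  {x | ∀ i, x i ∈ Set.Icc (0 : ℝ) 1}

/-- The length of the bipartite matching which pairs `x i` with `y (σ i)`: the sum of the
Euclidean lengths of its edges. -/
noncomputable def matchingLength {d N : ℕ} (x y : Fin N → EuclideanSpace ℝ (Fin d))
    (σ : Equiv.Perm (Fin N)) : ℝ :=
  ∑ i, dist (x i) (y (σ i))

/-- The length of a minimum bipartite matching of `x 0, …, x (N-1)` with `y 0, …, y (N-1)`: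
the minimum of the length over the finitely many bipartite matchings. -/
noncomputable def minMatchingLength {d N : ℕ} (x y : Fin N → EuclideanSpace ℝ (Fin d)) : ℝ :=
  Finset.univ.inf' Finset.univ_nonempty (matchingLength x y)

section OptCost

variable {ι ι' Q : Type*} [Fintype ι] [Fintype ι']

/-- The minimal cost, with respect to the cost function `D`, of a perfect matching between the
points `z (inl i)` and the points `z (inr i)`. -/
noncomputable def optCost (D : Q → Q → ℝ) (z : ι ⊕ ι → Q) : ℝ :=
  ⨅ σ : Equiv.Perm ι, ∑ i, D (z (Sum.inl i)) (z (Sum.inr (σ i)))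

theorem optCost_le (D : Q → Q → ℝ) (z : ι ⊕ ι → Q) (σ : Equiv.Perm ι) :
    optCost D z ≤ ∑ i, D (z (Sum.inl i)) (z (Sum.inr (σ i))) :=
  ciInf_le (Set.finite_range _).bddBelow σ

theorem exists_perm_optCost_eq (D : Q → Q → ℝ) (z : ι ⊕ ι → Q) :
    ∃ σ : Equiv.Perm ι, ∑ i, D (z (Sum.inl i)) (z (Sum.inr (σ i))) = optCost D z :=
  exists_eq_ciInf_of_finite

theorem optCost_nonneg {D : Q → Q → ℝ} (hD : ∀ u v, 0 ≤ D u v) (z : ι ⊕ ι → Q) :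
    0 ≤ optCost D z :=
  Real.iInf_nonneg fun _ => Finset.sum_nonneg fun _ _ => hD _ _

theorem optCost_le_card_mul {D : Q → Q → ℝ} {B : ℝ} (hB : ∀ u v, D u v ≤ B) (z : ι ⊕ ι → Q) :
    optCost D z ≤ Fintype.card ι * B := by
  refine (optCost_le D z 1).trans ((Finset.sum_le_sum fun _ _ => hB _ _).trans ?_)
  simp

theorem optCost_le_add_of_eqOn_compl {D : Q → Q → ℝ} {B : ℝ} (hD : ∀ u v, 0 ≤ D u v)
    (hB : ∀ u v, D u v ≤ B) (z z' : ι ⊕ ι → Q) (s : Finset (ι ⊕ ι)) (h : ∀ k ∉ s, z k = z' k) :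
    optCost D z ≤ optCost D z' + B * s.card := by
  classical
  obtain ⟨σ, hσ⟩ := exists_perm_optCost_eq D z'
  have hB0 : ∀ u : Q, 0 ≤ B := fun u => (hD u u).trans (hB u u)
  have key : ∀ i, D (z (Sum.inl i)) (z (Sum.inr (σ i))) ≤
      D (z' (Sum.inl i)) (z' (Sum.inr (σ i))) +
        ((if Sum.inl i ∈ s then B else 0) + (if Sum.inr (σ i) ∈ s then B else 0)) := by
    intro i
    have h0 := hB0 (z (Sum.inl i))
    have h1 := hD (z' (Sum.inl i)) (z' (Sum.inr (σ i)))
    have h2 := hB (z (Sum.inl i)) (z (Sum.inr (σ i)))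
    by_cases ha : Sum.inl i ∈ s
    · simp only [ha, if_true]; split_ifs <;> linarith
    · by_cases hb : Sum.inr (σ i) ∈ s
      · simp only [ha, hb, if_true, if_false]; linarith
      · simp [ha, hb, h _ ha, h _ hb]
  calc optCost D z ≤ _ := optCost_le D z σ
    _ ≤ _ := Finset.sum_le_sum fun i _ => key i
    _ = optCost D z' + B * s.card := by
      rw [Finset.sum_add_distrib, hσ, Finset.sum_add_distrib,
        Equiv.sum_comp σ (fun j => if Sum.inr j ∈ s then B else 0)]
      have : B * s.card = ∑ k : ι ⊕ ι, if k ∈ s then B else 0 := by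
        simp [mul_comm]
      rw [this, Fintype.sum_sum_type]

theorem optCost_comp_map_le (D : Q → Q → ℝ) (z : ι ⊕ ι → Q) (e f : ι' ≃ ι) :
    optCost D z ≤ optCost D (z ∘ Sum.map e f) := by
  obtain ⟨σ, hσ⟩ := exists_perm_optCost_eq D (z ∘ Sum.map e f)
  rw [← hσ]
  refine (optCost_le D z (e.symm.trans (σ.trans f))).trans_eq ?_
  rw [← Equiv.sum_comp e]
  simp

theorem optCost_comp_map (D : Q → Q → ℝ) (z : ι ⊕ ι → Q) (e f : ι' ≃ ι) :
    optCost D (z ∘ Sum.map e f) = optCost D z := by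
  refine le_antisymm ?_ (optCost_comp_map_le D z e f)
  refine (optCost_comp_map_le D _ e.symm f.symm).trans_eq ?_
  congr 1
  ext (i | i) <;> simp

theorem optCost_sum_le (D : Q → Q → ℝ) (z : (ι ⊕ ι') ⊕ (ι ⊕ ι') → Q) :
    optCost D z ≤ optCost D (z ∘ Sum.map Sum.inl Sum.inl) +
      optCost D (z ∘ Sum.map Sum.inr Sum.inr) := by
  obtain ⟨σ, hσ⟩ := exists_perm_optCost_eq D (z ∘ Sum.map Sum.inl Sum.inl)
  obtain ⟨τ, hτ⟩ := exists_perm_optCost_eq D (z ∘ Sum.map Sum.inr Sum.inr)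
  rw [← hσ, ← hτ]
  refine (optCost_le D z (Equiv.Perm.sumCongr σ τ)).trans_eq ?_
  simp [Fintype.sum_sum_type]

theorem optCost_prod_le (D : Q → Q → ℝ) (z : (ι' × ι) ⊕ (ι' × ι) → Q) :
    optCost D z ≤ ∑ c, optCost D (z ∘ Sum.map (Prod.mk c) (Prod.mk c)) := by
  choose σ hσ using fun c => exists_perm_optCost_eq D (z ∘ Sum.map (Prod.mk c) (Prod.mk c))
  refine (optCost_le D z (Equiv.prodCongrRight σ)).trans_eq ?_
  rw [Fintype.sum_prod_type]
  exact Finset.sum_congr rfl fun c _ => by rw [← hσ c]; simp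

theorem optCost_eq_mul {D : Q → Q → ℝ} {r : ℝ} (hr : 0 ≤ r) (z w : ι ⊕ ι → Q)
    (h : ∀ k l, D (w k) (w l) = r * D (z k) (z l)) : optCost D w = r * optCost D z := by
  simp only [optCost, h, ← Finset.mul_sum]
  exact (Real.mul_iInf_of_nonneg hr _).symm

theorem measurable_optCost [MeasurableSpace Q] {D : Q → Q → ℝ}
    (hD : Measurable (Function.uncurry D)) : Measurable (optCost (ι := ι) D) := by
  unfold optCost
  refine Measurable.iInf fun σ => Finset.measurable_fun_sum _ fun i _ => ?_
  have h : Measurable fun z : ι ⊕ ι → Q => (z (Sum.inl i), z (Sum.inr (σ i))) :=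
    (measurable_pi_apply _).prodMk (measurable_pi_apply _)
  exact hD.comp h

/-- Every coordinate which is not closer than `r` to all of the other side contributes `r`. -/
theorem le_optCost {D : Q → Q → ℝ} (hD : ∀ u v, 0 ≤ D u v) {r : ℝ} (hr : 0 ≤ r) (z : ι ⊕ ι → Q) :
    r * (Fintype.card ι - ∑ i, ∑ j, {p : Q × Q | D p.1 p.2 < r}.indicator 1
      (z (Sum.inl i), z (Sum.inr j))) ≤ optCost D z := by
  obtain ⟨σ, hσ⟩ := exists_perm_optCost_eq D z
  have hnn : ∀ p : Q × Q, (0 : ℝ) ≤ {p : Q × Q | D p.1 p.2 < r}.indicator 1 p := fun p =>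
    Set.indicator_nonneg (fun _ _ => zero_le_one) _
  have key : ∀ i, r * (1 - ∑ j, {p : Q × Q | D p.1 p.2 < r}.indicator (1 : Q × Q → ℝ)
      (z (Sum.inl i), z (Sum.inr j))) ≤ D (z (Sum.inl i)) (z (Sum.inr (σ i))) := by
    intro i
    have h1 : {p : Q × Q | D p.1 p.2 < r}.indicator (1 : Q × Q → ℝ)
        (z (Sum.inl i), z (Sum.inr (σ i))) ≤ ∑ j, {p : Q × Q | D p.1 p.2 < r}.indicator
          (1 : Q × Q → ℝ) (z (Sum.inl i), z (Sum.inr j)) :=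
      Finset.single_le_sum (f := fun j => {p : Q × Q | D p.1 p.2 < r}.indicator
          (1 : Q × Q → ℝ) (z (Sum.inl i), z (Sum.inr j))) (fun j _ => hnn _) (Finset.mem_univ (σ i))
    have h0 := hD (z (Sum.inl i)) (z (Sum.inr (σ i)))
    have h2 := mul_le_mul_of_nonneg_left h1 hr
    by_cases h : D (z (Sum.inl i)) (z (Sum.inr (σ i))) < r
    · rw [Set.indicator_of_mem (by exact h)] at h2
      simp only [Pi.one_apply] at h2
      linarith
    · have h3 := mul_nonneg hr ((hnn _).trans h1)
      linarith
  rw [← hσ]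
  refine le_trans (le_of_eq ?_) (Finset.sum_le_sum fun i _ => key i)
  rw [← Finset.mul_sum, Finset.sum_sub_distrib]
  simp

end OptCost

/-- Relabelling the coordinates of an i.i.d. family along an injection gives an i.i.d. family. -/
theorem measurePreserving_comp_injective {κ κ' Q : Type*} [Fintype κ] [Fintype κ']
    [MeasurableSpace Q] (μ : Measure Q) [IsProbabilityMeasure μ] {e : κ' → κ}
    (he : Function.Injective e) :
    MeasurePreserving (fun z : κ → Q => z ∘ e) (Measure.pi fun _ => μ) (Measure.pi fun _ => μ) := by
  refine ⟨measurable_pi_lambda _ fun i => measurable_pi_apply _, ?_⟩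
  have h : iIndepFun (fun (i : κ) (z : κ → Q) => z i) (Measure.pi fun _ => μ) :=
    iIndepFun_pi (X := fun _ => id) fun _ => aemeasurable_id
  have h' := (h.precomp he).map_fun_eq_pi_map fun i => (measurable_pi_apply _).aemeasurable
  simp only [Function.comp_def, (measurePreserving_eval (fun _ : κ => μ) _).map_eq] at h' ⊢
  exact h'

section MeanCost

variable {Q : Type*} [MeasurableSpace Q]

/-- The expected minimal cost of a matching of `N` points with `N` points, all drawn
independently from `μ`. -/
noncomputable def meanCost (D : Q → Q → ℝ) (μ : Measure Q) (N : ℕ) : ℝ :=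
  ∫ z : Fin N ⊕ Fin N → Q, optCost D z ∂Measure.pi fun _ => μ

variable {D : Q → Q → ℝ} {B : ℝ} {μ : Measure Q}

theorem integrable_optCost {Ω ι : Type*} [Fintype ι] [MeasurableSpace Ω] {P : Measure Ω}
    [IsFiniteMeasure P] (hD : Measurable (Function.uncurry D)) (h0 : ∀ u v, 0 ≤ D u v)
    (hB : ∀ u v, D u v ≤ B) {f : Ω → ι ⊕ ι → Q} (hf : Measurable f) :
    Integrable (fun ω => optCost D (f ω)) P :=
  Integrable.of_mem_Icc 0 (Fintype.card ι * B) ((measurable_optCost hD).comp hf).aemeasurable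
    (ae_of_all _ fun _ => ⟨optCost_nonneg h0 _, optCost_le_card_mul hB _⟩)

theorem meanCost_nonneg (h0 : ∀ u v, 0 ≤ D u v) (N : ℕ) : 0 ≤ meanCost D μ N :=
  integral_nonneg fun _ => optCost_nonneg h0 _

variable [IsProbabilityMeasure μ]

theorem integral_optCost_comp (hD : Measurable (Function.uncurry D)) {ι κ : Type*} [Fintype ι]
    [Fintype κ] {e : ι ⊕ ι → κ} (he : Function.Injective e) :
    ∫ z : κ → Q, optCost D (z ∘ e) ∂(Measure.pi fun _ => μ) = meanCost D μ (Fintype.card ι) := by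
  have h1 := measurePreserving_comp_injective μ he
  let f := Fintype.equivFin ι
  have h2 := measurePreserving_comp_injective μ (Sum.map_injective.2 ⟨f.injective, f.injective⟩)
  calc _ = ∫ z : ι ⊕ ι → Q, optCost D z ∂(Measure.pi fun _ => μ) := by
        rw [← h1.map_eq, integral_map h1.measurable.aemeasurable]
        exact (measurable_optCost hD).aestronglyMeasurable
    _ = _ := by
        rw [meanCost, ← h2.map_eq, integral_map h2.measurable.aemeasurable]
        · exact integral_congr_ae (ae_of_all _ fun z => optCost_comp_map D z f f)
        · exact (measurable_optCost hD).aestronglyMeasurable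

theorem meanCost_le (hD : Measurable (Function.uncurry D)) (h0 : ∀ u v, 0 ≤ D u v)
    (hB : ∀ u v, D u v ≤ B) (N : ℕ) : meanCost D μ N ≤ B * N := by
  refine (integral_mono (integrable_optCost hD h0 hB measurable_id) (integrable_const _)
    fun z => optCost_le_card_mul hB z).trans_eq ?_
  simp [mul_comm]

theorem meanCost_add_le (hD : Measurable (Function.uncurry D)) (h0 : ∀ u v, 0 ≤ D u v)
    (hB : ∀ u v, D u v ≤ B) (N k : ℕ) :
    meanCost D μ (N + k) ≤ meanCost D μ N + meanCost D μ k := by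
  have e0 := integral_optCost_comp (μ := μ) hD
    (Function.injective_id (α := (Fin N ⊕ Fin k) ⊕ (Fin N ⊕ Fin k)))
  have e1 := integral_optCost_comp (μ := μ) hD
    (Sum.map_injective.2 ⟨Sum.inl_injective (α := Fin N) (β := Fin k),
      Sum.inl_injective (α := Fin N) (β := Fin k)⟩)
  have e2 := integral_optCost_comp (μ := μ) hD
    (Sum.map_injective.2 ⟨Sum.inr_injective (α := Fin N) (β := Fin k),
      Sum.inr_injective (α := Fin N) (β := Fin k)⟩)
  simp only [Fintype.card_sum, Fintype.card_fin] at e0 e1 e2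
  have i1 := measurePreserving_comp_injective μ
    (Sum.map_injective.2 ⟨Sum.inl_injective (α := Fin N) (β := Fin k),
      Sum.inl_injective (α := Fin N) (β := Fin k)⟩)
  have i2 := measurePreserving_comp_injective μ
    (Sum.map_injective.2 ⟨Sum.inr_injective (α := Fin N) (β := Fin k),
      Sum.inr_injective (α := Fin N) (β := Fin k)⟩)
  have j1 := integrable_optCost (P := Measure.pi fun _ => μ) hD h0 hB i1.measurable
  have j2 := integrable_optCost (P := Measure.pi fun _ => μ) hD h0 hB i2.measurable
  rw [← e0, ← e1, ← e2, ← integral_add j1 j2]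
  exact integral_mono (integrable_optCost hD h0 hB measurable_id) (j1.add j2)
    fun z => optCost_sum_le D z

theorem le_meanCost (hD : Measurable (Function.uncurry D)) (h0 : ∀ u v, 0 ≤ D u v)
    (hB : ∀ u v, D u v ≤ B) {r p : ℝ} (hr : 0 ≤ r)
    (hp : (μ.prod μ).real {q : Q × Q | D q.1 q.2 < r} ≤ p) (N : ℕ) :
    r * (N - N * (N * p)) ≤ meanCost D μ N := by
  have hS : MeasurableSet {q : Q × Q | D q.1 q.2 < r} := measurableSet_lt hD measurable_const
  have key : ∀ i j : Fin N, Integrable (fun z : Fin N ⊕ Fin N → Q =>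
      {p : Q × Q | D p.1 p.2 < r}.indicator (1 : Q × Q → ℝ) (z (Sum.inl i), z (Sum.inr j)))
        (Measure.pi fun _ => μ) ∧ ∫ z : Fin N ⊕ Fin N → Q,
      {p : Q × Q | D p.1 p.2 < r}.indicator (1 : Q × Q → ℝ) (z (Sum.inl i), z (Sum.inr j))
        ∂(Measure.pi fun _ => μ) ≤ p := by
    intro i j
    have hi : IndepFun (fun z : Fin N ⊕ Fin N → Q => z (Sum.inl i)) (fun z => z (Sum.inr j))
        (Measure.pi fun _ => μ) :=
      (iIndepFun_pi (X := fun _ => id) fun _ => aemeasurable_id).indepFun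
        (show Sum.inl i ≠ Sum.inr j by simp)
    have hm : Measurable fun z : Fin N ⊕ Fin N → Q => (z (Sum.inl i), z (Sum.inr j)) :=
      (measurable_pi_apply _).prodMk (measurable_pi_apply _)
    have hmap := (indepFun_iff_map_prod_eq_prod_map_map (measurable_pi_apply _).aemeasurable
      (measurable_pi_apply _).aemeasurable).1 hi
    simp only [(measurePreserving_eval (fun _ : Fin N ⊕ Fin N => μ) _).map_eq] at hmap
    have hint : Integrable ({p : Q × Q | D p.1 p.2 < r}.indicator (1 : Q × Q → ℝ)) (μ.prod μ) :=
      (integrable_const (1 : ℝ)).indicator hS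
    rw [← hmap] at hint
    refine ⟨hint.comp_measurable hm, ?_⟩
    rw [← integral_map (f := {p : Q × Q | D p.1 p.2 < r}.indicator (1 : Q × Q → ℝ))
      hm.aemeasurable hint.aestronglyMeasurable, hmap, integral_indicator_one hS]
    exact hp
  have hint1 : ∀ i : Fin N, Integrable (fun z : Fin N ⊕ Fin N → Q => ∑ j,
      {p : Q × Q | D p.1 p.2 < r}.indicator (1 : Q × Q → ℝ) (z (Sum.inl i), z (Sum.inr j)))
        (Measure.pi fun _ => μ) := fun i => integrable_finsetSum _ fun j _ => (key i j).1
  have hint2 := integrable_finsetSum (Finset.univ : Finset (Fin N)) fun i _ => hint1 i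
  refine le_trans ?_ (integral_mono
    (((integrable_const (Fintype.card (Fin N) : ℝ)).sub hint2).const_mul r)
    (integrable_optCost hD h0 hB measurable_id) fun z => le_optCost h0 hr z)
  simp only [Pi.sub_apply]
  rw [integral_const_mul, integral_sub (integrable_const _) hint2,
    integral_finsetSum _ fun i _ => hint1 i]
  simp only [integral_const, probReal_univ, Fintype.card_fin, one_smul]
  refine mul_le_mul_of_nonneg_left (sub_le_sub_left ?_ _) hr
  calc _ ≤ ∑ i : Fin N, ∑ j : Fin N, p := Finset.sum_le_sum fun i _ => by
        rw [integral_finsetSum _ fun j _ => (key i j).1]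
        exact Finset.sum_le_sum fun j _ => (key i j).2
    _ = _ := by simp

end MeanCost

/-- Any assignment of cells to the elements of `C × Fin n` agrees, after a permutation, with the
first projection except for the excess elements in overfull cells. -/
theorem exists_perm_card_ne_le {C : Type*} [Fintype C] [DecidableEq C] {n : ℕ}
    (I : C × Fin n → C) :
    ∃ π : Equiv.Perm (C × Fin n), (Finset.univ.filter fun k => I k ≠ (π k).1).card ≤
      ∑ c, ((Finset.univ.filter fun k => I k = c).card - n) := by
  classical
  have hS : ∀ c, ∃ S ⊆ Finset.univ.filter fun k => I k = c,
      S.card = min (Finset.univ.filter fun k => I k = c).card n := fun c =>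
    Finset.exists_subset_card_eq (min_le_left _ _)
  choose S hS hcard using hS
  have hemb : ∀ c, Nonempty (S c ↪ Fin n) := fun c => by
    apply Function.Embedding.nonempty_of_card_le
    simp [hcard c]
  let ψ : ∀ c, S c ↪ Fin n := fun c => (hemb c).some
  let φ : {k // k ∈ S (I k)} → C × Fin n := fun k => (I k, ψ (I k) ⟨k, k.2⟩)
  have hφ : Function.Injective φ := by
    rintro ⟨k, hk⟩ ⟨l, hl⟩ h
    simp only [φ, Prod.mk.injEq] at h
    obtain ⟨h1, h2⟩ := h
    have : ∀ c (hc : I k = c) (h : l ∈ S c), ψ (I k) ⟨k, hk⟩ = ψ c ⟨l, h⟩ → k = l := by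
      rintro c rfl h h'
      simpa using (ψ (I k)).injective h'
    exact Subtype.ext (this _ h1 hl h2)
  let e : {k // k ∈ S (I k)} ≃ {k // k ∈ Set.range φ} := Equiv.ofInjective φ hφ
  refine ⟨e.extendSubtype, ?_⟩
  calc _ ≤ (Finset.univ.filter fun k => k ∉ S (I k)).card := by
        refine Finset.card_le_card fun k hk => ?_
        simp only [Finset.mem_filter, Finset.mem_univ, true_and] at hk ⊢
        contrapose! hk
        rw [e.extendSubtype_apply_of_mem k hk]
        simp [e, φ]
    _ = ∑ c, ((Finset.univ.filter fun k => k ∉ S (I k)).filter fun k => I k = c).card :=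
        Finset.card_eq_sum_card_fiberwise fun _ _ => Finset.mem_univ _
    _ ≤ _ := Finset.sum_le_sum fun c _ => by
        have : ((Finset.univ.filter fun k => k ∉ S (I k)).filter fun k => I k = c) =
            (Finset.univ.filter fun k => I k = c) \ S c := by
          ext k
          simp only [Finset.mem_filter, Finset.mem_univ, true_and, Finset.mem_sdiff]
          constructor
          · rintro ⟨h, rfl⟩; exact ⟨rfl, h⟩
          · rintro ⟨rfl, h⟩; exact ⟨h, rfl⟩
        rw [this, Finset.card_sdiff_of_subset (hS c), hcard c]
        omega

theorem integral_abs_le_sqrt {Ω : Type*} [MeasurableSpace Ω] {P : Measure Ω}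
    [IsProbabilityMeasure P] {Y : Ω → ℝ} (hY : MemLp Y 2 P) :
    ∫ ω, |Y ω| ∂P ≤ √(∫ ω, Y ω ^ 2 ∂P) := by
  apply Real.le_sqrt_of_sq_le
  have h := variance_nonneg (fun ω => |Y ω|) P
  rw [variance_eq_sub (X := fun ω => |Y ω|) hY.abs] at h
  simp only [Pi.pow_apply, sq_abs] at h
  linarith

theorem integral_abs_card_sub_le {C : Type*} [Fintype C] [DecidableEq C] [MeasurableSpace C]
    [MeasurableSingletonClass C] {ν : Measure C} [IsProbabilityMeasure ν]
    (hν : ∀ c, ν.real {c} = (Fintype.card C : ℝ)⁻¹) (n : ℕ) (c : C) :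
    ∫ I : C × Fin n → C, |((Finset.univ.filter fun k => I k = c).card : ℝ) - n|
      ∂(Measure.pi fun _ => ν) ≤ √n := by
  let X : C × Fin n → C → ℝ := fun _ x => if x = c then 1 else 0
  have hX : ∀ k, MemLp (X k) 2 ν := fun k => MemLp.of_bound
    (measurable_of_finite _).aestronglyMeasurable 1 (ae_of_all _ fun x => by
      simp only [X]; split_ifs <;> simp)
  have hX1 : ∀ k, ∫ x, X k x ∂ν = (Fintype.card C : ℝ)⁻¹ := fun k => by
    rw [← hν c, ← integral_indicator_one (measurableSet_singleton c)]
    exact integral_congr_ae (ae_of_all _ fun x => by simp [X, Set.indicator_apply])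
  have hC : (Fintype.card C : ℝ) ≠ 0 := by
    have : Nonempty C := ⟨c⟩
    exact_mod_cast Fintype.card_ne_zero
  have hsum : ∀ I : C × Fin n → C, ((Finset.univ.filter fun k => I k = c).card : ℝ) =
      (∑ k, fun I : C × Fin n → C => X k (I k)) I := fun I => by
    simp [X, Finset.sum_apply]
  have hm : ∀ k, MemLp (fun I : C × Fin n → C => X k (I k)) 2 (Measure.pi fun _ => ν) := fun k =>
    (hX k).comp_measurePreserving (measurePreserving_eval (fun _ => ν) k)
  have hm' := memLp_finsetSum' Finset.univ fun k _ => hm k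
  have hmean : ∫ I, (∑ k, fun I : C × Fin n → C => X k (I k)) I ∂(Measure.pi fun _ => ν) = n := by
    simp only [Finset.sum_apply]
    rw [integral_finsetSum _ fun k _ => (hm k).integrable (by norm_num)]
    have : ∀ k, ∫ I : C × Fin n → C, X k (I k) ∂(Measure.pi fun _ => ν) =
        (Fintype.card C : ℝ)⁻¹ := fun k => by
      have h := integral_map (μ := Measure.pi fun _ : C × Fin n => ν) (f := X k)
        (measurable_pi_apply k).aemeasurable (measurable_of_finite _).aestronglyMeasurable
      rw [(measurePreserving_eval (fun _ : C × Fin n => ν) k).map_eq] at h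
      rw [← h, ← hX1 k]
    simp only [this, Finset.sum_const, Finset.card_univ, Fintype.card_prod, Fintype.card_fin,
      nsmul_eq_mul, Nat.cast_mul]
    field_simp
  have hvar : Var[∑ k, fun I : C × Fin n → C => X k (I k); Measure.pi fun _ => ν] ≤ n := by
    rw [variance_sum_pi hX]
    have : ∀ k, Var[X k; ν] ≤ (Fintype.card C : ℝ)⁻¹ := fun k => by
      refine (variance_le_expectation_sq (hX k).aestronglyMeasurable).trans_eq ?_
      rw [← hX1 k]
      refine integral_congr_ae (ae_of_all _ fun x => ?_)
      simp only [X, Pi.pow_apply]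
      split_ifs <;> simp
    refine (Finset.sum_le_sum fun k _ => this k).trans_eq ?_
    simp only [Finset.sum_const, Finset.card_univ, Fintype.card_prod, Fintype.card_fin,
      nsmul_eq_mul, Nat.cast_mul]
    field_simp
  simp only [hsum]
  refine (integral_abs_le_sqrt (hm'.sub (memLp_const (n : ℝ)))).trans (Real.sqrt_le_sqrt ?_)
  rw [variance_eq_integral hm'.aestronglyMeasurable.aemeasurable, hmean] at hvar
  exact hvar

/-- If `μ` is the average of its images under finitely many similarities `T c` of ratio `r`, then
the mean cost is approximately self-similar. -/
theorem meanCost_card_mul_le {Q : Type*} [MeasurableSpace Q] {D : Q → Q → ℝ} {B : ℝ}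
    {μ : Measure Q} [IsProbabilityMeasure μ] (hD : Measurable (Function.uncurry D))
    (h0 : ∀ u v, 0 ≤ D u v) (hB : ∀ u v, D u v ≤ B) (hB0 : 0 ≤ B) {C : Type*} [Fintype C]
    [MeasurableSpace C] [MeasurableSingletonClass C] {ν : Measure C} [IsProbabilityMeasure ν]
    (hν : ∀ c, ν.real {c} = (Fintype.card C : ℝ)⁻¹) {T : C × Q → Q}
    (hT : MeasurePreserving T (ν.prod μ) μ) {r : ℝ} (hr : 0 ≤ r)
    (hTD : ∀ c u v, D (T (c, u)) (T (c, v)) = r * D u v) (n : ℕ) :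
    meanCost D μ (Fintype.card C * n) ≤
      Fintype.card C * (r * meanCost D μ n) + 2 * B * (Fintype.card C * √n) := by
  classical
  let ι := C × Fin n
  let W : (ι ⊕ ι → C) × (ι ⊕ ι → Q) → (ι ⊕ ι → Q) := fun p k => T (p.1 k, p.2 k)
  have hW : MeasurePreserving W
      ((Measure.pi fun _ => ν).prod (Measure.pi fun _ => μ)) (Measure.pi fun _ => μ) :=
    (measurePreserving_pi (fun _ : ι ⊕ ι => ν.prod μ) (fun _ => μ) fun _ => hT).comp
      (measurePreserving_arrowProdEquivProdArrow C Q (ι ⊕ ι) (fun _ => ν) fun _ => μ).symm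
  let dev : (ι → C) → ℝ := fun I => ∑ c, |((Finset.univ.filter fun k => I k = c).card : ℝ) - n|
  have hdev : ∀ I : ι → C, ((∑ c, ((Finset.univ.filter fun k => I k = c).card - n) : ℕ) : ℝ) ≤
      dev I := fun I => by
    push_cast
    refine Finset.sum_le_sum fun c _ => ?_
    rcases le_total n (Finset.univ.filter fun k => I k = c).card with h | h
    · rw [Nat.cast_sub h]; exact le_abs_self _
    · rw [Nat.sub_eq_zero_of_le h]; simp
  have hdev_int : ∫ I, dev I ∂(Measure.pi fun _ => ν) ≤ Fintype.card C * √n := by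
    rw [integral_finsetSum _ fun c _ => Integrable.of_finite]
    refine (Finset.sum_le_sum fun c _ => integral_abs_card_sub_le hν n c).trans_eq ?_
    simp
  have hside : ∀ e : ι → ι ⊕ ι, Function.Injective e →
      ∫ I, dev (I ∘ e) ∂(Measure.pi fun _ => ν) ≤ Fintype.card C * √n := fun e he => by
    have h := measurePreserving_comp_injective ν he
    rw [← h.map_eq, integral_map h.measurable.aemeasurable
      (measurable_of_finite _).aestronglyMeasurable] at hdev_int
    exact hdev_int
  have hinner : ∀ I : ι ⊕ ι → C, ∫ U, optCost D (W (I, U)) ∂(Measure.pi fun _ => μ) ≤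
      Fintype.card C * (r * meanCost D μ n) + B * (dev (I ∘ Sum.inl) + dev (I ∘ Sum.inr)) := by
    intro I
    obtain ⟨π, hπ⟩ := exists_perm_card_ne_le (I ∘ Sum.inl)
    obtain ⟨ρ, hρ⟩ := exists_perm_card_ne_le (I ∘ Sum.inr)
    let e : C → Fin n ⊕ Fin n → ι ⊕ ι := fun c =>
      Sum.map (fun j => π.symm (c, j)) (fun j => ρ.symm (c, j))
    have he : ∀ c, Function.Injective (e c) := fun c => Sum.map_injective.2
      ⟨π.symm.injective.comp (Prod.mk_right_injective c),
        ρ.symm.injective.comp (Prod.mk_right_injective c)⟩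
    have hmeas : ∀ c, Measurable fun U : ι ⊕ ι → Q => U ∘ e c := fun c =>
      (measurePreserving_comp_injective μ (he c)).measurable
    let J : ι ⊕ ι → C := Sum.elim (fun k => (π k).1) (fun k => (ρ k).1)
    let s : Finset (ι ⊕ ι) := Finset.univ.filter fun k => I k ≠ J k
    have hs : (s.card : ℝ) ≤ dev (I ∘ Sum.inl) + dev (I ∘ Sum.inr) := by
      refine le_trans ?_ (add_le_add (hdev _) (hdev _))
      have : s.card = (Finset.univ.filter fun k => (I ∘ Sum.inl) k ≠ (π k).1).card +
          (Finset.univ.filter fun k => (I ∘ Sum.inr) k ≠ (ρ k).1).card := by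
        simp only [s, Finset.card_filter, Fintype.sum_sum_type]
        rfl
      rw [this]
      exact_mod_cast add_le_add hπ hρ
    have hpt : ∀ U : ι ⊕ ι → Q, optCost D (W (I, U)) ≤
        (∑ c, r * optCost D (U ∘ e c)) + B * s.card := by
      intro U
      refine (optCost_le_add_of_eqOn_compl h0 hB _ (W (J, U)) s fun k hk => ?_).trans
        (add_le_add_left ?_ _)
      · have : I k = J k := by simpa [s] using hk
        simp only [W, this]
      · refine (optCost_comp_map_le D _ π.symm ρ.symm).trans ((optCost_prod_le D _).trans
          (Finset.sum_le_sum fun c _ => le_of_eq (optCost_eq_mul hr _ _ ?_)))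
        rintro (k | k) (l | l) <;> simp [W, J, e, hTD]
    have hint : Integrable (fun U : ι ⊕ ι → Q => ∑ c, r * optCost D (U ∘ e c))
        (Measure.pi fun _ => μ) := integrable_finsetSum _ fun c _ =>
      (integrable_optCost hD h0 hB (hmeas c)).const_mul r
    have hWI : Measurable fun U : ι ⊕ ι → Q => W (I, U) :=
      hW.measurable.comp measurable_prodMk_left
    refine (integral_mono (integrable_optCost hD h0 hB hWI)
      (hint.add (integrable_const (B * (s.card : ℝ)))) hpt).trans ?_
    simp only [Pi.add_apply]
    rw [integral_add hint (integrable_const _), integral_finsetSum _ fun c _ =>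
      (integrable_optCost hD h0 hB (hmeas c)).const_mul r]
    refine add_le_add (le_of_eq ?_) ?_
    · simp [integral_const_mul, integral_optCost_comp hD (he _)]
    · simpa using mul_le_mul_of_nonneg_left hs hB0
  have e0 := integral_optCost_comp (μ := μ) hD (Function.injective_id (α := ι ⊕ ι))
  simp only [ι, Fintype.card_prod, Fintype.card_fin, Function.comp_id] at e0
  have hint2 : Integrable (fun p => optCost D (W p))
      ((Measure.pi fun _ => ν).prod (Measure.pi fun _ => μ)) :=
    integrable_optCost hD h0 hB hW.measurable
  rw [← e0, ← hW.map_eq, integral_map hW.measurable.aemeasurable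
    (measurable_optCost hD).aestronglyMeasurable, integral_prod _ hint2]
  refine (integral_mono hint2.integral_prod_left Integrable.of_finite hinner).trans ?_
  rw [integral_add Integrable.of_finite Integrable.of_finite, integral_const,
    integral_const_mul, integral_add Integrable.of_finite Integrable.of_finite]
  have h1 := hside Sum.inl Sum.inl_injective
  have h2 := hside Sum.inr Sum.inr_injective
  simp only [probReal_univ, one_smul]
  nlinarith [mul_le_mul_of_nonneg_left (add_le_add h1 h2) hB0]

section BoundedDifferences

variable {Q : Type*} [MeasurableSpace Q] {μ : Measure Q} [IsProbabilityMeasure μ]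

theorem integrable_of_abs_le {Ω : Type*} [MeasurableSpace Ω] {P : Measure Ω} [IsFiniteMeasure P]
    {f : Ω → ℝ} {M : ℝ} (hf : Measurable f) (hM : ∀ z, |f z| ≤ M) : Integrable f P :=
  Integrable.of_mem_Icc (-M) M hf.aemeasurable (ae_of_all _ fun z => abs_le.1 (hM z))

theorem integrable_exp_mul_sub_of_abs_le {Ω : Type*} [MeasurableSpace Ω] {P : Measure Ω}
    [IsFiniteMeasure P] {f : Ω → ℝ} {M : ℝ} (hf : Measurable f) (hM : ∀ z, |f z| ≤ M) (t m : ℝ) :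
    Integrable (fun ω => Real.exp (t * (f ω - m))) P := by
  refine integrable_exp_mul_of_mem_Icc (a := -M - m) (b := M - m)
    (hf.sub_const m).aemeasurable (ae_of_all _ fun z => ?_)
  have := abs_le.1 (hM z)
  constructor <;> linarith

theorem integral_exp_mul_sub_integral_le {f : Q → ℝ} {c : ℝ} (hf : Measurable f)
    (hc : ∀ q q', |f q - f q'| ≤ c) (t : ℝ) :
    ∫ q, Real.exp (t * (f q - ∫ q', f q' ∂μ)) ∂μ ≤ Real.exp (c ^ 2 * t ^ 2 / 2) := by
  obtain ⟨q₀⟩ : Nonempty Q := nonempty_of_isProbabilityMeasure μ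
  have h := (hasSubgaussianMGF_of_mem_Icc (μ := μ) (a := f q₀ - c) (b := f q₀ + c)
    hf.aemeasurable (ae_of_all _ fun q => by
      have := abs_le.1 (hc q q₀)
      constructor <;> linarith)).mgf_le t
  refine h.trans_eq ?_
  have h2 : f q₀ + c - (f q₀ - c) = 2 * c := by ring
  congr 3
  rw [h2]
  push_cast
  rw [Real.norm_eq_abs, abs_mul, abs_two, mul_div_cancel_left₀ _ two_ne_zero, sq_abs]

theorem integral_exp_le_of_update_fin {c : ℝ} (t : ℝ) (n : ℕ) (f : (Fin n → Q) → ℝ) (M : ℝ)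
    (hf : Measurable f) (hM : ∀ z, |f z| ≤ M)
    (hc : ∀ z i q, |f (Function.update z i q) - f z| ≤ c) :
    ∫ z, Real.exp (t * (f z - ∫ z', f z' ∂(Measure.pi fun _ => μ))) ∂(Measure.pi fun _ => μ) ≤
      Real.exp (n * c ^ 2 * t ^ 2 / 2) := by
  induction n with
  | zero =>
    have : ∀ z, f z = f default := fun z => congrArg f (Subsingleton.elim _ _)
    simp [this]
  | succ n ih =>
    let F : Q × (Fin n → Q) → ℝ := fun p => f (Fin.cons p.1 p.2)
    have hmp : MeasurePreserving (fun p : Q × (Fin n → Q) => (Fin.cons p.1 p.2 : Fin (n + 1) → Q))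
        (μ.prod (Measure.pi fun _ => μ)) (Measure.pi fun _ => μ) := by
      have := (measurePreserving_piFinSuccAbove (fun _ : Fin (n + 1) => μ) 0).symm
      convert this using 1
      ext p i
      simp [MeasurableEquiv.piFinSuccAbove]
    have hF : Measurable F := hf.comp hmp.measurable
    have hFM : ∀ p, |F p| ≤ M := fun p => hM _
    have hFi : Integrable F (μ.prod (Measure.pi fun _ => μ)) := integrable_of_abs_le hF hFM
    have hFs : ∀ z, Integrable (fun q => F (q, z)) μ := fun z =>
      integrable_of_abs_le (hF.comp measurable_prodMk_right) fun _ => hFM _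
    let g : (Fin n → Q) → ℝ := fun z => ∫ q, F (q, z) ∂μ
    have hg : Measurable g := hF.stronglyMeasurable.integral_prod_left'.measurable
    have hgM : ∀ z, |g z| ≤ M := fun z => by
      refine (abs_integral_le_integral_abs).trans ?_
      refine (integral_mono (hFs z).abs (integrable_const M) fun q => hFM _).trans_eq ?_
      simp
    have hgc : ∀ z i q, |g (Function.update z i q) - g z| ≤ c := fun z i q => by
      rw [← integral_sub (hFs _) (hFs _)]
      refine (abs_integral_le_integral_abs).trans ?_
      refine (integral_mono ((hFs _).sub (hFs _)).abs (integrable_const c) fun p => ?_).trans_eq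
        (by simp)
      simp only [Pi.sub_apply, F, Fin.cons_update]
      exact hc _ _ _
    have hm : ∫ z, f z ∂(Measure.pi fun _ => μ) = ∫ z, g z ∂(Measure.pi fun _ => μ) := by
      rw [← hmp.map_eq, integral_map hmp.measurable.aemeasurable hf.aestronglyMeasurable,
        integral_prod_symm _ hFi]
    have ih := ih g hg hgM hgc
    rw [hm]
    set m := ∫ z, g z ∂(Measure.pi fun _ => μ)
    have hexp := integrable_exp_mul_sub_of_abs_le (P := μ.prod (Measure.pi fun _ : Fin n => μ))
      hF hFM t m
    have hexpg := integrable_exp_mul_sub_of_abs_le (P := (Measure.pi fun _ : Fin n => μ))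
      hg hgM t m
    have hmeas : Measurable fun z => Real.exp (t * (f z - m)) := by fun_prop
    rw [← hmp.map_eq, integral_map hmp.measurable.aemeasurable hmeas.aestronglyMeasurable,
      integral_prod_symm _ hexp]
    calc _ ≤ ∫ z, Real.exp (c ^ 2 * t ^ 2 / 2) * Real.exp (t * (g z - m))
          ∂(Measure.pi fun _ => μ) := by
          refine integral_mono hexp.integral_prod_right (hexpg.const_mul _) fun z => ?_
          have hz := integral_exp_mul_sub_integral_le (μ := μ) (f := fun q => F (q, z)) (c := c)
            (hF.comp measurable_prodMk_right) (fun q q' => by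
              have := hc (Fin.cons q' z) 0 q
              rwa [Fin.update_cons_zero] at this) t
          refine le_trans (le_of_eq ?_) (mul_le_mul_of_nonneg_right hz (Real.exp_pos _).le)
          rw [← integral_mul_const]
          refine integral_congr_ae (ae_of_all _ fun q => ?_)
          simp only [← Real.exp_add, F]
          congr 1
          ring
      _ ≤ Real.exp (c ^ 2 * t ^ 2 / 2) * Real.exp (n * c ^ 2 * t ^ 2 / 2) := by
          rw [integral_const_mul]
          exact mul_le_mul_of_nonneg_left ih (Real.exp_pos _).le
      _ = _ := by
          rw [← Real.exp_add]
          congr 1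
          push_cast
          ring

/-- **Bounded differences inequality** (McDiarmid), with a non-optimal constant: a function of
independent coordinates which changes by at most `c` when one of them changes is sub-Gaussian. -/
theorem hasSubgaussianMGF_of_update {κ : Type*} [Fintype κ] [DecidableEq κ] {c : ℝ}
    {f : (κ → Q) → ℝ} {M : ℝ} (hf : Measurable f) (hM : ∀ z, |f z| ≤ M)
    (hc : ∀ z i q, |f (Function.update z i q) - f z| ≤ c) :
    HasSubgaussianMGF (fun z => f z - ∫ z', f z' ∂(Measure.pi fun _ => μ))
      (Real.toNNReal (Fintype.card κ * c ^ 2)) (Measure.pi fun _ => μ) := by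
  refine ⟨fun t => integrable_exp_mul_sub_of_abs_le hf hM t _, fun t => ?_⟩
  let e := Fintype.equivFin κ
  have h := measurePreserving_comp_injective μ e.injective
  have hfm := hf.comp h.measurable
  rw [mgf, Real.coe_toNNReal _ (by positivity)]
  have hmeas : ∀ m, Measurable fun z => Real.exp (t * (f z - m)) := fun m => by fun_prop
  have key := integral_exp_le_of_update_fin (μ := μ) t _ (fun z => f (z ∘ e)) M hfm
    (fun z => hM _) (c := c) fun z i q => by
      rw [← e.apply_symm_apply i, Function.update_comp_eq_of_injective _ e.injective]
      exact hc _ _ _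
  have h1 : ∫ z, f z ∂(Measure.pi fun _ : κ => μ) = ∫ z, f (z ∘ e) ∂(Measure.pi fun _ => μ) := by
    rw [← h.map_eq, integral_map h.measurable.aemeasurable hf.aestronglyMeasurable]
  rw [h1, ← h.map_eq, integral_map h.measurable.aemeasurable (hmeas _).aestronglyMeasurable]
  exact key

theorem measureReal_abs_sub_integral_ge_le {κ : Type*} [Fintype κ] [DecidableEq κ] {c : ℝ}
    {f : (κ → Q) → ℝ} {M : ℝ} (hf : Measurable f) (hM : ∀ z, |f z| ≤ M)
    (hc : ∀ z i q, |f (Function.update z i q) - f z| ≤ c) {ε : ℝ} (hε : 0 ≤ ε) :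
    (Measure.pi fun _ => μ).real {z | ε ≤ |f z - ∫ z', f z' ∂(Measure.pi fun _ => μ)|} ≤
      2 * Real.exp (-ε ^ 2 / (2 * (Fintype.card κ * c ^ 2))) := by
  have h := hasSubgaussianMGF_of_update (μ := μ) hf hM hc
  have h1 := h.measure_ge_le hε
  have h2 := h.neg.measure_ge_le hε
  rw [Real.coe_toNNReal _ (by positivity)] at h1 h2
  rw [two_mul (Real.exp _)]
  refine le_trans (measureReal_mono (fun z hz => ?_)) ((measureReal_union_le _ _).trans
    (add_le_add h1 h2))
  exact le_abs.1 (Set.mem_ofPred.1 hz)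

end BoundedDifferences

theorem exists_mul_two_pow_le {K : ℕ} (hK : 1 ≤ K) (m : ℕ) (hm : K ≤ m) :
    ∃ p k : ℕ, K ≤ p ∧ p < 2 * K ∧ p * 2 ^ k ≤ m ∧ m < (p + 1) * 2 ^ k := by
  induction m using Nat.strong_induction_on with
  | _ m ih =>
    rcases lt_or_ge m (2 * K) with h | h
    · exact ⟨m, 0, hm, h, by simp, by simp⟩
    · obtain ⟨p, k, h1, h2, h3, h4⟩ := ih (m / 2) (by omega) (by omega)
      refine ⟨p, k + 1, h1, h2, ?_, ?_⟩ <;> rw [pow_succ, ← mul_assoc] <;> omega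

theorem exists_pow_mul_le {d n N K : ℕ} (hd : d ≠ 0) (hn : 1 ≤ n) (hK : K ^ d * n ≤ N) :
    ∃ m, K ≤ m ∧ m ^ d * n ≤ N ∧ N < (m + 1) ^ d * n := by
  have hbound : ∀ m, m ^ d * n ≤ N → m ≤ N := fun m hm =>
    (Nat.le_self_pow hd m).trans ((Nat.le_mul_of_pos_right _ hn).trans hm)
  let m := Nat.findGreatest (fun m => m ^ d * n ≤ N) N
  have hm : m ^ d * n ≤ N := Nat.findGreatest_spec (P := fun m => m ^ d * n ≤ N) (hbound K hK) hK
  refine ⟨m, Nat.le_findGreatest (hbound K hK) hK, hm, ?_⟩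
  by_contra! h
  have := Nat.le_findGreatest (P := fun m => m ^ d * n ≤ N) (hbound _ h) h
  change m + 1 ≤ m at this
  omega

/-- A bounded sequence whose late terms are almost dominated by each earlier term converges. -/
theorem exists_tendsto_of_eventually_le_add {f : ℕ → ℝ} {b G : ℝ} (hb : ∀ᶠ n in atTop, b ≤ f n)
    (hG : ∀ᶠ n in atTop, f n ≤ G)
    (h : ∀ ε > 0, ∀ᶠ n in atTop, ∀ᶠ N in atTop, f N ≤ f n + ε) :
    ∃ β, b ≤ β ∧ Tendsto f atTop (𝓝 β) := by
  have hbu : IsBoundedUnder (· ≤ ·) atTop f := ⟨G, by simpa using hG⟩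
  have hbl : IsBoundedUnder (· ≥ ·) atTop f := ⟨b, by simpa using hb⟩
  have key : limsup f atTop ≤ liminf f atTop := by
    refine le_of_forall_pos_le_add fun ε hε => ?_
    rw [← sub_le_iff_le_add]
    refine le_liminf_of_le hbu.isCoboundedUnder_ge ?_
    filter_upwards [h ε hε] with n hn
    have := limsup_le_of_le hbl.isCoboundedUnder_le hn
    linarith
  exact ⟨_, le_liminf_of_le hbu.isCoboundedUnder_ge hb,
    tendsto_of_le_liminf_of_limsup_le le_rfl key hbu hbl⟩

section SelfSimilar

variable {d : ℕ} {a : ℕ → ℝ} {B : ℝ}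

theorem pow_mul_rpow_one_sub_inv (hd : 3 ≤ d) {m : ℝ} (hm : 0 < m) {n : ℝ} (hn : 0 ≤ n) :
    (m ^ d * n) ^ (1 - 1 / (d : ℝ)) = m ^ d * m⁻¹ * n ^ (1 - 1 / (d : ℝ)) := by
  have hd0 : (d : ℝ) ≠ 0 := by positivity
  rw [Real.mul_rpow (by positivity) hn, ← Real.rpow_natCast m d, ← Real.rpow_mul hm.le,
    ← Real.rpow_neg_one m, ← Real.rpow_add hm]
  congr 2
  field_simp
  ring

theorem rpow_ratio_pow_mul_le (hd : 3 ≤ d)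
    (hC : ∀ m n : ℕ, 1 ≤ m →
      a (m ^ d * n) ≤ (m : ℝ) ^ d * ((m : ℝ)⁻¹ * a n) + 2 * B * ((m : ℝ) ^ d * √n))
    {m n : ℕ} (hm : 1 ≤ m) (hn : 1 ≤ n) :
    a (m ^ d * n) / ((m ^ d * n : ℕ) : ℝ) ^ (1 - 1 / (d : ℝ)) ≤
      a n / (n : ℝ) ^ (1 - 1 / (d : ℝ)) + 2 * B * m * (n : ℝ) ^ (-(1 / 2 - 1 / (d : ℝ))) := by
  have hm' : (0 : ℝ) < m := by exact_mod_cast hm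
  have hn' : (0 : ℝ) < n := by exact_mod_cast hn
  push_cast
  rw [pow_mul_rpow_one_sub_inv hd hm' hn'.le, div_le_iff₀ (by positivity)]
  refine (hC m n hm).trans_eq ?_
  have h1 : (n : ℝ) ^ (-(1 / 2 - 1 / (d : ℝ))) * (n : ℝ) ^ (1 - 1 / (d : ℝ)) = √n := by
    rw [← Real.rpow_add hn', Real.sqrt_eq_rpow]
    congr 1
    ring
  rw [← h1]
  field_simp

theorem exists_rpow_ratio_div_le (hd : 3 ≤ d) (hB : 0 ≤ B) (h0 : ∀ n, 0 ≤ a n)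
    (hadd : ∀ n k, a (n + k) ≤ a n + a k) (hle : ∀ n : ℕ, a n ≤ B * n)
    (hC : ∀ m n : ℕ, 1 ≤ m →
      a (m ^ d * n) ≤ (m : ℝ) ^ d * ((m : ℝ)⁻¹ * a n) + 2 * B * ((m : ℝ) ^ d * √n)) :
    ∃ B' : ℝ, 0 ≤ B' ∧ ∀ N : ℕ, 2 ^ d ≤ N →
      a N / (N : ℝ) ^ (1 - 1 / (d : ℝ)) + B' * (N : ℝ) ^ (-(1 / 2 - 1 / (d : ℝ))) ≤
      a (N / 2 ^ d) / ((N / 2 ^ d : ℕ) : ℝ) ^ (1 - 1 / (d : ℝ)) +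
        B' * ((N / 2 ^ d : ℕ) : ℝ) ^ (-(1 / 2 - 1 / (d : ℝ))) := by
  have hd' : (3 : ℝ) ≤ d := by exact_mod_cast hd
  have hdinv : 1 / (d : ℝ) ≤ 1 / 3 := one_div_le_one_div_of_le (by norm_num) hd'
  set s := 1 - 1 / (d : ℝ) with hs
  set δ := 1 / 2 - 1 / (d : ℝ) with hδ
  have hδ0 : 0 < δ := by linarith
  have hsδ : δ ≤ s := by linarith
  set θ : ℝ := ((2 : ℝ) ^ d) ^ (-δ) with hθ
  have hθ1 : θ < 1 := Real.rpow_lt_one_of_one_lt_of_neg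
    (one_lt_pow₀ (by norm_num) (by omega)) (by linarith)
  have h1θ : 0 < 1 - θ := by linarith
  refine ⟨(4 * B + B * 2 ^ d) / (1 - θ), by positivity, fun N hN => ?_⟩
  set B' := (4 * B + B * 2 ^ d) / (1 - θ) with hB'
  have hB'0 : 0 ≤ B' := by positivity
  have hB'1 : 4 * B + B * 2 ^ d + B' * θ = B' := by
    rw [hB']
    field_simp
    ring
  set n := N / 2 ^ d with hn
  have hn1 : 1 ≤ n := (Nat.one_le_div_iff (by positivity)).2 hN
  have hn0 : (0 : ℝ) < n := by exact_mod_cast hn1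
  have hsplit : N = 2 ^ d * n + N % 2 ^ d := (Nat.div_add_mod N (2 ^ d)).symm
  have hle' : 2 ^ d * n ≤ N := Nat.mul_div_le N (2 ^ d)
  have hpos : (0 : ℝ) < (2 ^ d * n : ℕ) := by positivity
  have hleR : ((2 ^ d * n : ℕ) : ℝ) ≤ N := by exact_mod_cast hle'
  have hN0 : (0 : ℝ) < N := hpos.trans_le hleR
  have haN : a N ≤ a (2 ^ d * n) + B * 2 ^ d := by
    conv_lhs => rw [hsplit]
    refine (hadd _ _).trans (add_le_add le_rfl ((hle _).trans ?_))
    gcongr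
    exact_mod_cast (Nat.mod_lt N (by positivity)).le
  have hscale := rpow_ratio_pow_mul_le hd hC (m := 2) (n := n) (by norm_num) hn1
  rw [← hs, ← hδ] at hscale
  have hmono : ((N : ℝ) ^ s)⁻¹ ≤ (((2 ^ d * n : ℕ) : ℝ) ^ s)⁻¹ :=
    inv_anti₀ (by positivity) (Real.rpow_le_rpow hpos.le hleR (by linarith))
  have hns : ((N : ℝ) ^ s)⁻¹ ≤ (n : ℝ) ^ (-δ) := by
    rw [Real.rpow_neg hn0.le]
    refine inv_anti₀ (by positivity) ?_
    calc (n : ℝ) ^ δ ≤ (n : ℝ) ^ s := Real.rpow_le_rpow_of_exponent_le (by exact_mod_cast hn1) hsδ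
      _ ≤ (N : ℝ) ^ s := Real.rpow_le_rpow hn0.le (by exact_mod_cast Nat.div_le_self N _)
        (by linarith)
  have hNδ : (N : ℝ) ^ (-δ) ≤ θ * (n : ℝ) ^ (-δ) := by
    rw [hθ, ← Real.mul_rpow (by positivity) hn0.le]
    refine Real.rpow_le_rpow_of_nonpos (by positivity) (by exact_mod_cast hle') (by linarith)
  have ha2 : a N / (N : ℝ) ^ s ≤
      a (2 ^ d * n) / ((2 ^ d * n : ℕ) : ℝ) ^ s + B * 2 ^ d * (n : ℝ) ^ (-δ) := by
    rw [div_eq_mul_inv, div_eq_mul_inv]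
    calc a N * ((N : ℝ) ^ s)⁻¹ ≤ (a (2 ^ d * n) + B * 2 ^ d) * ((N : ℝ) ^ s)⁻¹ := by gcongr
      _ = a (2 ^ d * n) * ((N : ℝ) ^ s)⁻¹ + B * 2 ^ d * ((N : ℝ) ^ s)⁻¹ := add_mul _ _ _
      _ ≤ _ := add_le_add (mul_le_mul_of_nonneg_left hmono (h0 _))
        (mul_le_mul_of_nonneg_left hns (by positivity))
  calc a N / (N : ℝ) ^ s + B' * (N : ℝ) ^ (-δ)
      ≤ (a n / (n : ℝ) ^ s + 2 * B * (2 : ℕ) * (n : ℝ) ^ (-δ)) + B * 2 ^ d * (n : ℝ) ^ (-δ)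
        + B' * (θ * (n : ℝ) ^ (-δ)) := by
        have := mul_le_mul_of_nonneg_left hNδ hB'0
        linarith
    _ = a n / (n : ℝ) ^ s + (4 * B + B * 2 ^ d + B' * θ) * (n : ℝ) ^ (-δ) := by
        push_cast
        ring
    _ = _ := by rw [hB'1]

/-- An approximately self-similar subadditive sequence grows exactly like `n ^ (1 - 1 / d)`. -/
theorem exists_tendsto_rpow_ratio (hd : 3 ≤ d) (hB : 0 ≤ B) (h0 : ∀ n, 0 ≤ a n)
    (hadd : ∀ n k, a (n + k) ≤ a n + a k) (hle : ∀ n : ℕ, a n ≤ B * n)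
    (hC : ∀ m n : ℕ, 1 ≤ m →
      a (m ^ d * n) ≤ (m : ℝ) ^ d * ((m : ℝ)⁻¹ * a n) + 2 * B * ((m : ℝ) ^ d * √n))
    {c : ℝ} (hc : 0 < c) (hlow : ∀ n : ℕ, 1 ≤ n → c ≤ a n / (n : ℝ) ^ (1 - 1 / (d : ℝ))) :
    ∃ β : ℝ, 0 < β ∧ Tendsto (fun n : ℕ => a n / (n : ℝ) ^ (1 - 1 / (d : ℝ))) atTop (𝓝 β) := by
  have hd' : (3 : ℝ) ≤ d := by exact_mod_cast hd
  have hdinv : 1 / (d : ℝ) ≤ 1 / 3 := one_div_le_one_div_of_le (by norm_num) hd'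
  obtain ⟨B', hB', hg⟩ := exists_rpow_ratio_div_le hd hB h0 hadd hle hC
  have hf := fun m n hm hn => rpow_ratio_pow_mul_le hd hC (m := m) (n := n) hm hn
  set s := 1 - 1 / (d : ℝ) with hs
  set δ := 1 / 2 - 1 / (d : ℝ) with hδ
  have hδ0 : 0 < δ := by linarith
  have hs0 : 0 < s := by linarith
  set f : ℕ → ℝ := fun n => a n / (n : ℝ) ^ s with hfdef
  set g : ℕ → ℝ := fun n => f n + B' * (n : ℝ) ^ (-δ) with hgdef
  have hg' : ∀ N : ℕ, 2 ^ d ≤ N → g N ≤ g (N / 2 ^ d) := hg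
  have hfg : ∀ n, f n ≤ g n := fun n => le_add_of_nonneg_right (by positivity)
  have hrpow_le_one : ∀ n : ℕ, 1 ≤ n → (n : ℝ) ^ (-δ) ≤ 1 := fun n hn =>
    Real.rpow_le_one_of_one_le_of_nonpos (by exact_mod_cast hn) (by linarith)
  obtain ⟨G, hG0, hG⟩ : ∃ G : ℝ, 0 ≤ G ∧ ∀ n : ℕ, 1 ≤ n → f n ≤ G := by
    refine ⟨B * 2 ^ d + B', by positivity, fun n hn => (hfg n).trans ?_⟩
    induction n using Nat.strong_induction_on with
    | _ n ih =>
      rcases lt_or_ge n (2 ^ d) with h | h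
      · have hn' : (1 : ℝ) ≤ n := by exact_mod_cast hn
        have h1 : f n ≤ a n := div_le_self (h0 n) (Real.one_le_rpow hn' hs0.le)
        have h2 : a n ≤ B * 2 ^ d := (hle n).trans (by gcongr; exact_mod_cast h.le)
        have h3 := mul_le_mul_of_nonneg_left (hrpow_le_one n hn) hB'
        simp only [hgdef]
        linarith
      · exact (hg' n h).trans (ih _ (Nat.div_lt_self hn (one_lt_pow₀ (by norm_num) (by omega)))
          ((Nat.one_le_div_iff (by positivity)).2 h))
  have hiter : ∀ k n : ℕ, 1 ≤ n → g ((2 ^ k) ^ d * n) ≤ g n := by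
    intro k
    induction k with
    | zero => intro n _; simp
    | succ k ih =>
      intro n hn
      have h1 : (2 ^ (k + 1)) ^ d * n = 2 ^ d * ((2 ^ k) ^ d * n) := by
        rw [pow_succ, mul_pow]; ring
      rw [h1]
      have hpos : 0 < (2 ^ k) ^ d * n := by positivity
      refine (hg' _ (Nat.le_mul_of_pos_right _ hpos)).trans ?_
      rw [Nat.mul_div_cancel_left _ (by positivity)]
      exact ih n hn
  have haG : ∀ n : ℕ, a n ≤ G * (n : ℝ) ^ s := by
    intro n
    rcases Nat.eq_zero_or_pos n with rfl | hn
    · refine (hle 0).trans ?_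
      simp [Real.zero_rpow hs0.ne']
    · exact (div_le_iff₀ (by positivity)).1 (hG n hn)
  have main : ∀ K n N : ℕ, 1 ≤ K → 1 ≤ n → K ^ d * n ≤ N →
      f N ≤ f n + (4 * B * K + B') * (n : ℝ) ^ (-δ) + G * ((1 + 1 / (K : ℝ)) ^ d - 1) ^ s := by
    intro K n N hK hn hN
    obtain ⟨m, hKm, hm1, hm2⟩ := exists_pow_mul_le (by omega) hn hN
    obtain ⟨p, k, hp1, hp2, hp3, hp4⟩ := exists_mul_two_pow_le hK m hKm
    have hp : 1 ≤ p := hK.trans hp1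
    obtain ⟨r, hr⟩ := Nat.exists_eq_add_of_le
      ((Nat.mul_le_mul_right n (Nat.pow_le_pow_left hp3 d)).trans hm1)
    set N' := (p * 2 ^ k) ^ d * n with hN'
    have hN'pos : 0 < N' := by positivity
    have hN'R : (0 : ℝ) < N' := by exact_mod_cast hN'pos
    have hNN' : (N' : ℝ) ≤ N := by rw [hr]; push_cast; linarith [(Nat.cast_nonneg r : (0 : ℝ) ≤ r)]
    have hNR : (0 : ℝ) < N := hN'R.trans_le hNN'
    have hNup : (N : ℝ) ≤ ((p + 1) * 2 ^ k) ^ d * n := by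
      have : N ≤ ((p + 1) * 2 ^ k) ^ d * n :=
        hm2.le.trans (Nat.mul_le_mul_right n (Nat.pow_le_pow_left hp4 d))
      exact_mod_cast this
    have hpR : (0 : ℝ) < p := by exact_mod_cast hp
    have hKR : (0 : ℝ) < K := by exact_mod_cast hK
    have hη : (r : ℝ) ≤ ((1 + 1 / (K : ℝ)) ^ d - 1) * N := by
      have h1 : (N : ℝ) ≤ (1 + 1 / (K : ℝ)) ^ d * N' := by
        refine hNup.trans ?_
        have h2 : ((p : ℝ) + 1) * 2 ^ k ≤ (1 + 1 / (K : ℝ)) * (p * 2 ^ k) := by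
          have : (1 : ℝ) ≤ 1 / K * p := by
            rw [one_div, inv_mul_eq_div, le_div_iff₀ hKR]
            simpa using (show (K : ℝ) ≤ p by exact_mod_cast hp1)
          nlinarith [show (0 : ℝ) < 2 ^ k by positivity]
        rw [hN']
        push_cast
        rw [← mul_assoc, ← mul_pow]
        gcongr
      have h3 : (N : ℝ) = N' + r := by exact_mod_cast hr
      have h4 : (1 : ℝ) ≤ (1 + 1 / (K : ℝ)) ^ d := one_le_pow₀ (by simp)
      nlinarith [mul_le_mul_of_nonneg_left hNN' (sub_nonneg.2 h4)]
    have hη0 : (0 : ℝ) ≤ (1 + 1 / (K : ℝ)) ^ d - 1 := sub_nonneg.2 (one_le_pow₀ (by simp))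
    have e1 : f N ≤ f N' + G * ((1 + 1 / (K : ℝ)) ^ d - 1) ^ s := by
      have h1 : a N ≤ a N' + G * (r : ℝ) ^ s := by
        rw [hr]; exact (hadd _ _).trans (add_le_add le_rfl (haG r))
      have h2 : (r : ℝ) ^ s ≤ ((1 + 1 / (K : ℝ)) ^ d - 1) ^ s * (N : ℝ) ^ s := by
        rw [← Real.mul_rpow hη0 hNR.le]
        exact Real.rpow_le_rpow (by positivity) hη hs0.le
      have h3 : a N' ≤ f N' * (N : ℝ) ^ s := by
        rw [hfdef]
        simp only
        rw [div_mul_eq_mul_div, le_div_iff₀ (by positivity)]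
        exact mul_le_mul_of_nonneg_left (Real.rpow_le_rpow hN'R.le hNN' hs0.le) (h0 _)
      rw [show f N = a N / (N : ℝ) ^ s from rfl, div_le_iff₀ (by positivity)]
      nlinarith [mul_le_mul_of_nonneg_left h2 hG0]
    have e2 : f N' ≤ g (p ^ d * n) := by
      have : N' = (2 ^ k) ^ d * (p ^ d * n) := by rw [hN', mul_pow]; ring
      rw [this]
      exact (hfg _).trans (hiter k _ (show 0 < p ^ d * n by positivity))
    have e3 : g (p ^ d * n) ≤ f n + (4 * B * K + B') * (n : ℝ) ^ (-δ) := by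
      have h1 := hf p n hp hn
      have hn' : (0 : ℝ) < n := by exact_mod_cast hn
      have h2 : ((p ^ d * n : ℕ) : ℝ) ^ (-δ) ≤ (n : ℝ) ^ (-δ) :=
        Real.rpow_le_rpow_of_nonpos hn'
          (by exact_mod_cast Nat.le_mul_of_pos_left n (by positivity)) (by linarith)
      have h3 : 2 * B * p * (n : ℝ) ^ (-δ) ≤ 4 * B * K * (n : ℝ) ^ (-δ) := by
        have : (p : ℝ) ≤ 2 * K := by exact_mod_cast hp2.le
        refine mul_le_mul_of_nonneg_right ?_ (by positivity)
        nlinarith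
      have h4 := mul_le_mul_of_nonneg_left h2 hB'
      simp only [hgdef, hfdef] at h1 ⊢
      linarith
    linarith
  obtain ⟨β, hβ, hlim⟩ := exists_tendsto_of_eventually_le_add (f := f) (b := c) (G := G)
    (eventually_atTop.2 ⟨1, hlow⟩) (eventually_atTop.2 ⟨1, hG⟩) fun ε hε => by
      have l1 : Tendsto (fun K : ℕ => G * ((1 + 1 / (K : ℝ)) ^ d - 1) ^ s) atTop (𝓝 0) := by
        have h1 : Tendsto (fun K : ℕ => (1 + 1 / (K : ℝ)) ^ d - 1) atTop (𝓝 0) := by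
          simpa using ((tendsto_one_div_atTop_nhds_zero_nat (𝕜 := ℝ)).const_add 1).pow d
            |>.sub_const 1
        have h2 := (h1.rpow_const (Or.inr hs0.le : _ ∨ 0 ≤ s)).const_mul G
        simpa [Real.zero_rpow hs0.ne'] using h2
      obtain ⟨K, hK1, hK⟩ := ((eventually_ge_atTop 1).and
        (l1.eventually (gt_mem_nhds (half_pos hε)))).exists
      have l2 : Tendsto (fun n : ℕ => (4 * B * K + B') * (n : ℝ) ^ (-δ)) atTop (𝓝 0) := by
        simpa using ((tendsto_rpow_neg_atTop hδ0).comp tendsto_natCast_atTop_atTop).const_mul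
          (4 * B * K + B')
      filter_upwards [eventually_ge_atTop 1, l2.eventually (gt_mem_nhds (half_pos hε))]
        with n hn hn2
      filter_upwards [eventually_ge_atTop (K ^ d * n)] with N hN
      have := main K n N hK1 hn hN
      linarith
  exact ⟨β, hc.trans_le hβ, hlim⟩

end SelfSimilar

theorem summable_exp_neg_mul_rpow {K q : ℝ} (hK : 0 < K) (hq : 0 < q) :
    Summable fun n : ℕ => Real.exp (-K * (n : ℝ) ^ q) := by
  have h := ((isLittleO_exp_neg_mul_rpow_atTop hK (-2 / q)).comp_tendsto
    ((tendsto_rpow_atTop hq).comp tendsto_natCast_atTop_atTop)).isBigO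
  refine summable_of_isBigO_nat (Real.summable_nat_rpow.2 (by norm_num : (-2 : ℝ) < -1)) ?_
  refine h.congr (fun n => rfl) fun n => ?_
  simp only [Function.comp]
  rw [← Real.rpow_mul (Nat.cast_nonneg n), mul_div_cancel₀ _ hq.ne']

section AlmostSure

variable {Q : Type*} [MeasurableSpace Q] {D : Q → Q → ℝ} {B : ℝ} {μ : Measure Q}
  [IsProbabilityMeasure μ]

theorem measureReal_abs_optCost_sub_meanCost_ge_le (hD : Measurable (Function.uncurry D))
    (h0 : ∀ u v, 0 ≤ D u v) (hB : ∀ u v, D u v ≤ B) (N : ℕ) {ε : ℝ} (hε : 0 ≤ ε) :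
    (Measure.pi fun _ : Fin N ⊕ Fin N => μ).real {z | ε ≤ |optCost D z - meanCost D μ N|} ≤
      2 * Real.exp (-ε ^ 2 / (2 * ((N + N) * B ^ 2))) := by
  classical
  have h := measureReal_abs_sub_integral_ge_le (μ := μ) (c := B)
    (measurable_optCost (ι := Fin N) hD) (M := Fintype.card (Fin N) * B) (fun z => by
      rw [abs_of_nonneg (optCost_nonneg h0 z)]
      exact optCost_le_card_mul hB z) (fun z i q => by
      have h1 := optCost_le_add_of_eqOn_compl h0 hB (Function.update z i q) z {i} (fun k hk => by
        simp only [Finset.mem_singleton] at hk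
        simp [hk])
      have h2 := optCost_le_add_of_eqOn_compl h0 hB z (Function.update z i q) {i} (fun k hk => by
        simp only [Finset.mem_singleton] at hk
        simp [hk])
      simp only [Finset.card_singleton, Nat.cast_one, mul_one] at h1 h2
      exact abs_le.2 ⟨by linarith, by linarith⟩) hε
  simpa [meanCost] using h

theorem ae_tendsto_optCost_sub_meanCost_div (hD : Measurable (Function.uncurry D))
    (h0 : ∀ u v, 0 ≤ D u v) (hB : ∀ u v, D u v ≤ B) (hB0 : 0 < B) {s : ℝ} (hs : 1 / 2 < s)
    {Ω : Type*} [MeasurableSpace Ω] {P : Measure Ω} {Z : ℕ ⊕ ℕ → Ω → Q}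
    (hZ : ∀ k, Measurable (Z k)) (hμ : ∀ k, P.map (Z k) = μ) (hind : iIndepFun Z P) :
    ∀ᵐ ω ∂P, Tendsto (fun N : ℕ => (optCost D (fun k : Fin N ⊕ Fin N =>
      Z (Sum.map Fin.val Fin.val k) ω) - meanCost D μ N) / (N : ℝ) ^ s) atTop (𝓝 0) := by
  have := hind.isProbabilityMeasure
  let S : ∀ N : ℕ, Ω → Fin N ⊕ Fin N → Q := fun N ω k => Z (Sum.map Fin.val Fin.val k) ω
  have hS : ∀ N, MeasurePreserving (S N) P (Measure.pi fun _ => μ) := fun N => by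
    refine ⟨measurable_pi_lambda _ fun k => hZ _, ?_⟩
    have h := (hind.precomp (Sum.map_injective.2 ⟨Fin.val_injective (n := N),
      Fin.val_injective (n := N)⟩)).map_fun_eq_pi_map fun k => (hZ _).aemeasurable
    simp only [hμ] at h
    exact h
  have key : ∀ ε : ℝ, 0 < ε → ∀ᵐ ω ∂P, ∀ᶠ N : ℕ in atTop,
      ω ∉ {ω | ε * (N : ℝ) ^ s ≤ |optCost D (S N ω) - meanCost D μ N|} := by
    intro ε hε
    refine ae_eventually_notMem ?_
    have hbound : ∀ N : ℕ, P.real {ω | ε * (N : ℝ) ^ s ≤ |optCost D (S N ω) - meanCost D μ N|} ≤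
        2 * Real.exp (-(ε ^ 2 / (4 * B ^ 2)) * (N : ℝ) ^ (2 * s - 1)) := fun N => by
      have hm : MeasurableSet {z : Fin N ⊕ Fin N → Q |
          ε * (N : ℝ) ^ s ≤ |optCost D z - meanCost D μ N|} :=
        measurableSet_le measurable_const ((measurable_optCost hD).sub_const _).abs
      have h := (hS N).measureReal_preimage hm.nullMeasurableSet
      refine (h.le.trans (measureReal_abs_optCost_sub_meanCost_ge_le hD h0 hB N
        (by positivity))).trans_eq ?_
      congr 2
      rcases Nat.eq_zero_or_pos N with rfl | hN
      · rw [Nat.cast_zero, Real.zero_rpow (by linarith : 2 * s - 1 ≠ 0)]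
        simp
      · have hN' : (0 : ℝ) < N := by exact_mod_cast hN
        rw [Real.rpow_sub_one hN'.ne', mul_comm 2 s, Real.rpow_mul hN'.le, Real.rpow_two]
        field_simp
        ring
    have hsum : Summable fun N : ℕ =>
        P.real {ω | ε * (N : ℝ) ^ s ≤ |optCost D (S N ω) - meanCost D μ N|} :=
      Summable.of_nonneg_of_le (fun _ => measureReal_nonneg) hbound
        ((summable_exp_neg_mul_rpow (by positivity) (by linarith)).mul_left 2)
    have := hsum.tsum_ofReal_ne_top
    simpa [ofReal_measureReal] using this
  have hall : ∀ᵐ ω ∂P, ∀ j : ℕ, ∀ᶠ N : ℕ in atTop,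
      ω ∉ {ω | 1 / ((j : ℝ) + 1) * (N : ℝ) ^ s ≤ |optCost D (S N ω) - meanCost D μ N|} :=
    ae_all_iff.2 fun j => key _ (by positivity)
  filter_upwards [hall] with ω hω
  rw [Metric.tendsto_nhds]
  intro ε hε
  obtain ⟨j, hj⟩ := exists_nat_one_div_lt hε
  filter_upwards [hω j, eventually_ge_atTop 1] with N hN hN1
  have hN' : (0 : ℝ) < N := by exact_mod_cast hN1
  have hpos : (0 : ℝ) < (N : ℝ) ^ s := Real.rpow_pos_of_pos hN' s
  rw [Real.dist_eq, sub_zero, abs_div, abs_of_pos hpos, div_lt_iff₀ hpos]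
  have h1 : |optCost D (S N ω) - meanCost D μ N| < 1 / ((j : ℝ) + 1) * (N : ℝ) ^ s := by
    simpa using hN
  exact h1.trans_le (mul_le_mul_of_nonneg_right hj.le hpos.le)

end AlmostSure

section UnitIntervalCells

/-- The affine bijection of the unit interval onto the `c`-th of `m` consecutive intervals of
equal length. -/
noncomputable def intervalCell (m : ℕ) (p : Fin m × unitInterval) : unitInterval :=
  ⟨((p.1 : ℝ) + p.2) / m, by
    have hm : (0 : ℝ) < m := by exact_mod_cast p.1.pos
    have h1 : ((p.1 : ℕ) : ℝ) + 1 ≤ m := by exact_mod_cast p.1.isLt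
    have h2 := p.2.2.1
    have h3 := p.2.2.2
    constructor
    · positivity
    · rw [div_le_one hm]; linarith⟩

theorem measurable_intervalCell (m : ℕ) : Measurable (intervalCell m) := by
  refine Measurable.subtype_mk ?_
  exact (((measurable_of_finite (fun c : Fin m => ((c : ℕ) : ℝ))).comp measurable_fst).add
    (measurable_subtype_coe.comp measurable_snd)).div_const _

/-- The uniform probability measure on `Fin m`. -/
noncomputable def uniformFin (m : ℕ) : Measure (Fin m) := (m : ENNReal)⁻¹ • Measure.count

theorem uniformFin_singleton {m : ℕ} (c : Fin m) : uniformFin m {c} = (m : ENNReal)⁻¹ := by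
  simp [uniformFin]

instance isProbabilityMeasure_uniformFin (m : ℕ) [NeZero m] :
    IsProbabilityMeasure (uniformFin m) := ⟨by
  simp only [uniformFin, Measure.smul_apply, smul_eq_mul, Measure.count_univ,
    ENat.card_eq_coe_fintype_card, Fintype.card_fin]
  exact ENNReal.inv_mul_cancel (by simpa using NeZero.ne m) (by simp)⟩

theorem volume_coe_le (y : ℝ) :
    volume {u : unitInterval | (u : ℝ) ≤ y} = ENNReal.ofReal (min (max y 0) 1) := by
  rcases le_total 0 y with h0 | h0
  · rcases le_total y 1 with h1 | h1
    · have : {u : unitInterval | (u : ℝ) ≤ y} = Set.Iic ⟨y, h0, h1⟩ := rfl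
      rw [this, unitInterval.volume_Iic, max_eq_left h0, min_eq_left h1]
    · have : {u : unitInterval | (u : ℝ) ≤ y} = Set.univ :=
        Set.eq_univ_of_forall fun u => u.2.2.trans h1
      rw [this, measure_univ, max_eq_left h0, min_eq_right h1, ENNReal.ofReal_one]
  · have : {u : unitInterval | (u : ℝ) ≤ y} ⊆ Set.Iic 0 := fun u hu => hu.trans h0
    rw [max_eq_right h0, min_eq_left zero_le_one, ENNReal.ofReal_zero]
    refine measure_mono_null this ?_
    rw [unitInterval.volume_Iic]
    simp

theorem sum_clamp_sub {y : ℝ} (hy : 0 ≤ y) (m : ℕ) :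
    ∑ c ∈ Finset.range m, min (max (y - c) 0) 1 = min y m := by
  induction m with
  | zero => simp [hy]
  | succ m ih =>
    rw [Finset.sum_range_succ, ih]
    push_cast
    rcases le_total y m with h | h
    · rw [max_eq_right (by linarith), min_eq_left zero_le_one, min_eq_left h,
        min_eq_left (by linarith), add_zero]
    · rw [max_eq_left (by linarith), min_eq_right h]
      rcases le_total y (m + 1) with h' | h'
      · rw [min_eq_left (by linarith), min_eq_left h']; ring
      · rw [min_eq_right (by linarith), min_eq_right h']

theorem measurePreserving_intervalCell (m : ℕ) [NeZero m] :
    MeasurePreserving (intervalCell m) ((uniformFin m).prod volume) volume := by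
  refine ⟨measurable_intervalCell m, ?_⟩
  have := Measure.isProbabilityMeasure_map (μ := (uniformFin m).prod volume)
    (measurable_intervalCell m).aemeasurable
  refine Measure.ext_of_Iic _ _ fun x => ?_
  have hm : (0 : ℝ) < m := by exact_mod_cast NeZero.pos m
  have hmem : ∀ c : Fin m, Prod.mk c ⁻¹' (intervalCell m ⁻¹' Set.Iic x) =
      {u : unitInterval | (u : ℝ) ≤ m * x - (c : ℕ)} := fun c => by
    ext u
    simp only [Set.mem_preimage, Set.mem_Iic, ← Subtype.coe_le_coe, intervalCell,
      Set.mem_ofPred_eq, div_le_iff₀ hm]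
    constructor <;> intro h <;> linarith
  rw [Measure.map_apply (measurable_intervalCell m) measurableSet_Iic,
    Measure.prod_apply (measurable_intervalCell m measurableSet_Iic), unitInterval.volume_Iic,
    uniformFin, lintegral_smul_measure, lintegral_count, tsum_fintype]
  simp only [hmem, volume_coe_le]
  rw [← ENNReal.ofReal_sum_of_nonneg (fun c _ => by positivity),
    Fin.sum_univ_eq_sum_range (fun c : ℕ => min (max ((m : ℝ) * x - c) 0) 1) m,
    sum_clamp_sub (mul_nonneg hm.le x.2.1), min_eq_left (mul_le_of_le_one_right hm.le x.2.2),
    smul_eq_mul, ENNReal.ofReal_mul hm.le, ENNReal.ofReal_natCast, ← mul_assoc,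
    ENNReal.inv_mul_cancel (by simpa using NeZero.ne m) (by simp), one_mul]

end UnitIntervalCells

section Cube

variable {d : ℕ}

/-- The inclusion of the cube, as a power of the unit interval, into Euclidean space. -/
noncomputable def cubeEmb (d : ℕ) (u : Fin d → unitInterval) : EuclideanSpace ℝ (Fin d) :=
  WithLp.toLp 2 fun i => (u i : ℝ)

/-- The coordinatewise projection of Euclidean space onto the cube. -/
noncomputable def cubeProj (d : ℕ) (x : EuclideanSpace ℝ (Fin d)) : Fin d → unitInterval :=
  fun i => Set.projIcc 0 1 zero_le_one (x i)

theorem cubeProj_cubeEmb (u : Fin d → unitInterval) : cubeProj d (cubeEmb d u) = u := by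
  ext i
  simp [cubeProj, cubeEmb, Set.projIcc_val]

theorem cubeEmb_cubeProj {x : EuclideanSpace ℝ (Fin d)} (hx : x ∈ unitCube d) :
    cubeEmb d (cubeProj d x) = x := by
  ext i
  simp [cubeProj, cubeEmb, Set.projIcc_of_mem zero_le_one (hx i)]

theorem measurable_cubeProj : Measurable (cubeProj d) := by
  refine measurable_pi_lambda _ fun i => continuous_projIcc.measurable.comp ?_
  fun_prop

theorem measurableSet_unitCube : MeasurableSet (unitCube d) := by
  have : unitCube d = ⋂ i, (fun x : EuclideanSpace ℝ (Fin d) => x i) ⁻¹' Set.Icc 0 1 := by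
    ext x; simp [unitCube]
  rw [this]
  exact MeasurableSet.iInter fun i => measurableSet_Icc.preimage (by fun_prop)

theorem measurePreserving_cubeEmb :
    MeasurePreserving (cubeEmb d) volume (volume.restrict (unitCube d)) := by
  have h1 : MeasurePreserving (fun (u : Fin d → unitInterval) i => (u i : ℝ)) volume
      (Measure.pi fun _ => volume.restrict (Set.Icc (0 : ℝ) 1)) :=
    measurePreserving_pi (fun _ => volume) _ fun _ => unitInterval.measurePreserving_coe
  have h2 := (PiLp.volume_preserving_toLp (Fin d)).restrict_preimage
    (measurableSet_unitCube (d := d))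
  have h3 : (Measure.pi fun _ : Fin d => volume.restrict (Set.Icc (0 : ℝ) 1)) =
      (volume : Measure (Fin d → ℝ)).restrict (WithLp.toLp 2 ⁻¹' unitCube d) := by
    rw [← Measure.restrict_pi_pi, ← volume_pi]
    congr 1
    ext x
    simp [unitCube, Pi.le_def, forall_and]
  rw [h3] at h1
  exact h2.comp h1

/-- The Euclidean distance between points of the cube. -/
noncomputable def cubeDist (d : ℕ) (u v : Fin d → unitInterval) : ℝ :=
  dist (cubeEmb d u) (cubeEmb d v)

theorem cubeDist_eq (u v : Fin d → unitInterval) :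
    cubeDist d u v = √(∑ i, ((u i : ℝ) - v i) ^ 2) := by
  simp [cubeDist, EuclideanSpace.dist_eq, cubeEmb, Real.dist_eq]

theorem measurable_cubeDist : Measurable (Function.uncurry (cubeDist d)) :=
  (measurePreserving_cubeEmb.measurable.comp measurable_fst).dist
    (measurePreserving_cubeEmb.measurable.comp measurable_snd)

theorem cubeDist_le (u v : Fin d → unitInterval) : cubeDist d u v ≤ √d := by
  rw [cubeDist_eq]
  refine Real.sqrt_le_sqrt ((Finset.sum_le_sum (g := fun _ => (1 : ℝ)) fun i _ => ?_).trans_eq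
    (by simp))
  rw [sq_le_one_iff_abs_le_one, abs_le]
  have h1 := (u i).2.1
  have h2 := (u i).2.2
  have h3 := (v i).2.1
  have h4 := (v i).2.2
  constructor <;> linarith

theorem abs_sub_le_cubeDist (u v : Fin d → unitInterval) (i : Fin d) :
    |(v i : ℝ) - u i| ≤ cubeDist d u v := by
  rw [cubeDist_eq]
  apply Real.abs_le_sqrt
  rw [← neg_sub, neg_sq]
  exact Finset.single_le_sum (f := fun i => ((u i : ℝ) - v i) ^ 2) (fun _ _ => sq_nonneg _)
    (Finset.mem_univ i)

/-- The similarity of the cube onto the subcube with index `p.1` in the partition into `m ^ d`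
subcubes. -/
noncomputable def cubeCell (d m : ℕ) (p : (Fin d → Fin m) × (Fin d → unitInterval)) :
    Fin d → unitInterval :=
  fun i => intervalCell m (p.1 i, p.2 i)

theorem measurePreserving_cubeCell (d m : ℕ) [NeZero m] :
    MeasurePreserving (cubeCell d m) ((Measure.pi fun _ => uniformFin m).prod volume) volume :=
  (measurePreserving_pi (fun _ : Fin d => (uniformFin m).prod volume) (fun _ => volume)
    fun _ => measurePreserving_intervalCell m).comp
    (measurePreserving_arrowProdEquivProdArrow (Fin m) unitInterval (Fin d)
      (fun _ => uniformFin m) fun _ => volume).symm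

theorem cubeDist_cubeCell (m : ℕ) (c : Fin d → Fin m) (u v : Fin d → unitInterval) :
    cubeDist d (cubeCell d m (c, u)) (cubeCell d m (c, v)) = (m : ℝ)⁻¹ * cubeDist d u v := by
  rw [cubeDist_eq, cubeDist_eq, ← Real.sqrt_sq (show (0 : ℝ) ≤ (m : ℝ)⁻¹ by positivity),
    ← Real.sqrt_mul (sq_nonneg _), Finset.mul_sum]
  congr 1
  refine Finset.sum_congr rfl fun i _ => ?_
  simp only [cubeCell, intervalCell]
  ring

theorem real_pi_uniformFin_singleton (m : ℕ) [NeZero m] (c : Fin d → Fin m) :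
    (Measure.pi fun _ : Fin d => uniformFin m).real {c} =
      (Fintype.card (Fin d → Fin m) : ℝ)⁻¹ := by
  rw [Measure.real, Measure.pi_singleton]
  simp [uniformFin_singleton]

theorem real_prod_cubeDist_lt_le {r : ℝ} (hr : 0 ≤ r) :
    ((volume : Measure (Fin d → unitInterval)).prod volume).real
      {q | cubeDist d q.1 q.2 < r} ≤ (2 * r) ^ d := by
  have hS : MeasurableSet {q : (Fin d → unitInterval) × (Fin d → unitInterval) |
      cubeDist d q.1 q.2 < r} := measurableSet_lt measurable_cubeDist measurable_const
  refine ENNReal.toReal_le_of_le_ofReal (by positivity) ?_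
  rw [Measure.prod_apply hS]
  have h1 : ∀ x : unitInterval, volume {v : unitInterval | |(v : ℝ) - x| < r} ≤
      ENNReal.ofReal (2 * r) := fun x => by
    rw [unitInterval.volume_apply]
    have : Subtype.val '' {v : unitInterval | |(v : ℝ) - x| < r} ⊆
        Set.Ioo ((x : ℝ) - r) (x + r) := by
      rintro _ ⟨v, hv, rfl⟩
      have := abs_lt.1 (show |(v : ℝ) - x| < r from hv)
      constructor <;> linarith
    refine (measure_mono this).trans_eq ?_
    rw [Real.volume_Ioo]
    congr 1
    ring
  have h2 : ∀ u : Fin d → unitInterval, volume (Prod.mk u ⁻¹'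
      {q : (Fin d → unitInterval) × (Fin d → unitInterval) | cubeDist d q.1 q.2 < r}) ≤
      ENNReal.ofReal ((2 * r) ^ d) := fun u => by
    have : Prod.mk u ⁻¹' {q : (Fin d → unitInterval) × (Fin d → unitInterval) |
        cubeDist d q.1 q.2 < r} ⊆ Set.univ.pi fun i => {v : unitInterval | |(v : ℝ) - u i| < r} :=
      fun v hv i _ => (abs_sub_le_cubeDist u v i).trans_lt hv
    refine (measure_mono this).trans ?_
    rw [volume_pi, Measure.pi_pi]
    refine (Finset.prod_le_prod' fun i _ => h1 (u i)).trans_eq ?_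
    simp [ENNReal.ofReal_pow (by positivity : 0 ≤ 2 * r)]
  refine (lintegral_mono h2).trans_eq ?_
  simp

theorem exists_tendsto_meanCost_cubeDist (hd : 3 ≤ d) :
    ∃ β : ℝ, 0 < β ∧ Tendsto (fun n : ℕ =>
      meanCost (cubeDist d) volume n / (n : ℝ) ^ (1 - 1 / (d : ℝ))) atTop (𝓝 β) := by
  have hnn : ∀ u v, 0 ≤ cubeDist d u v := fun u v => dist_nonneg
  have hd0 : (d : ℝ) ≠ 0 := by positivity
  refine exists_tendsto_rpow_ratio (B := √d) (c := (1 / 2) ^ (1 / (d : ℝ)) / 4) hd (by positivity)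
    (meanCost_nonneg hnn) (meanCost_add_le measurable_cubeDist hnn cubeDist_le)
    (meanCost_le measurable_cubeDist hnn cubeDist_le) (fun m n hm => ?_) (by positivity)
    fun n hn => ?_
  · have : NeZero m := ⟨by omega⟩
    have h := meanCost_card_mul_le measurable_cubeDist hnn cubeDist_le (Real.sqrt_nonneg d)
      (real_pi_uniformFin_singleton m) (measurePreserving_cubeCell d m)
      (by positivity) (cubeDist_cubeCell m) n
    simpa using h
  · have hn' : (0 : ℝ) < n := by exact_mod_cast hn
    let r : ℝ := (1 / (2 * n)) ^ (1 / (d : ℝ)) / 2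
    have hr : 0 ≤ r := by positivity
    have h2r : (2 * r) ^ d = 1 / (2 * n) := by
      rw [show 2 * r = (1 / (2 * (n : ℝ))) ^ (1 / (d : ℝ)) by simp only [r]; ring,
        ← Real.rpow_natCast, ← Real.rpow_mul (by positivity), one_div_mul_cancel hd0,
        Real.rpow_one]
    have h := le_meanCost measurable_cubeDist hnn cubeDist_le hr
      ((real_prod_cubeDist_lt_le hr).trans_eq h2r) n
    rw [le_div_iff₀ (by positivity)]
    refine le_trans (le_of_eq ?_) h
    have h3 : (1 / (2 * (n : ℝ))) ^ (1 / (d : ℝ)) =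
        (1 / 2) ^ (1 / (d : ℝ)) * ((n : ℝ) ^ (1 / (d : ℝ)))⁻¹ := by
      rw [← Real.inv_rpow hn'.le, ← Real.mul_rpow (by positivity) (by positivity)]
      congr 1
      field_simp
    simp only [r]
    rw [h3, Real.rpow_sub hn', Real.rpow_one]
    field_simp
    ring

theorem map_cubeProj_of_isUniform {Ω : Type*} [MeasurableSpace Ω] {P : Measure Ω}
    {X : Ω → EuclideanSpace ℝ (Fin d)} (hX : Measurable X)
    (hU : pdf.IsUniform X (unitCube d) P volume) :
    P.map (fun ω => cubeProj d (X ω)) = volume ∧ ∀ᵐ ω ∂P, X ω ∈ unitCube d := by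
  have hE := measurePreserving_cubeEmb (d := d)
  have hvol : volume (unitCube d) = 1 := by
    have := hE.measure_preimage MeasurableSet.univ.nullMeasurableSet
    simpa using this.symm
  have hmap : P.map X = volume.restrict (unitCube d) := by
    have : P.map X = _ := hU
    rw [this, ProbabilityTheory.cond, hvol]
    simp
  constructor
  · change P.map (cubeProj d ∘ X) = volume
    rw [← Measure.map_map measurable_cubeProj hX, hmap, ← hE.map_eq,
      Measure.map_map measurable_cubeProj hE.measurable,
      show cubeProj d ∘ cubeEmb d = id from funext cubeProj_cubeEmb, Measure.map_id]
  · have h : ∀ᵐ x ∂(P.map X), x ∈ unitCube d := by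
      rw [hmap]
      exact ae_restrict_mem measurableSet_unitCube
    exact ae_of_ae_map hX.aemeasurable h

end Cube

theorem theorem1 (d : ℕ) (hd : 3 ≤ d) :
    ∃ β : ℝ, 0 < β ∧
      ∀ (Ω : Type*) [MeasurableSpace Ω] (P : Measure Ω) [IsProbabilityMeasure P]
        (X Y : ℕ → Ω → EuclideanSpace ℝ (Fin d)),
        (∀ i, Measurable (X i)) → (∀ i, Measurable (Y i)) →
        (∀ i, pdf.IsUniform (X i) (unitCube d) P volume) →
        (∀ i, pdf.IsUniform (Y i) (unitCube d) P volume) →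
        iIndepFun (Sum.elim X Y) P →
        ∀ᵐ ω ∂P, Tendsto
          (fun N : ℕ =>
            minMatchingLength (fun i : Fin N => X i ω) (fun i : Fin N => Y i ω) /
              (N : ℝ) ^ (1 - 1 / (d : ℝ)))
          atTop (𝓝 β) := by
  obtain ⟨β, hβ, hlim⟩ := exists_tendsto_meanCost_cubeDist hd
  refine ⟨β, hβ, fun Ω _ P _ X Y hX hY hXU hYU hind => ?_⟩
  have hd' : (3 : ℝ) ≤ d := by exact_mod_cast hd
  have hdinv : 1 / (d : ℝ) ≤ 1 / 3 := one_div_le_one_div_of_le (by norm_num) hd'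
  let Z : ℕ ⊕ ℕ → Ω → Fin d → unitInterval := fun k ω => cubeProj d (Sum.elim X Y k ω)
  have hXY : ∀ k, Measurable (Sum.elim X Y k) := by rintro (i | i); exacts [hX i, hY i]
  have hXYU : ∀ k, pdf.IsUniform (Sum.elim X Y k) (unitCube d) P volume := by
    rintro (i | i); exacts [hXU i, hYU i]
  have hZ : ∀ k, Measurable (Z k) := fun k => measurable_cubeProj.comp (hXY k)
  have hZind : iIndepFun Z P := hind.comp (fun _ => cubeProj d) fun _ => measurable_cubeProj
  have hconc := ae_tendsto_optCost_sub_meanCost_div (measurable_cubeDist (d := d))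
    (fun _ _ => dist_nonneg) cubeDist_le (B := √d) (by positivity) (s := 1 - 1 / (d : ℝ))
    (by linarith) hZ (fun k => (map_cubeProj_of_isUniform (hXY k) (hXYU k)).1) hZind
  have hmem : ∀ᵐ ω ∂P, ∀ k, Sum.elim X Y k ω ∈ unitCube d :=
    ae_all_iff.2 fun k => (map_cubeProj_of_isUniform (hXY k) (hXYU k)).2
  filter_upwards [hconc, hmem] with ω h1 h2
  have h3 := h1.add hlim
  rw [zero_add] at h3
  refine h3.congr fun N => ?_
  rw [← add_div, sub_add_cancel]
  congr 1
  rw [minMatchingLength, Finset.inf'_univ_eq_ciInf, optCost]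
  refine iInf_congr fun σ => Finset.sum_congr rfl fun i _ => ?_
  have hx := cubeEmb_cubeProj (h2 (Sum.inl i))
  have hy := cubeEmb_cubeProj (h2 (Sum.inr (σ i)))
  simp only [Sum.elim_inl, Sum.elim_inr] at hx hy
  simp [cubeDist, Z, hx, hy]
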